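/- Let $R$ be a complete discrete valuation ring with uniformizer $\pi$ and fraction field $K$, and let $G$ be a flat affine group scheme over $R$ (not assumed of finite type), with ring of functions $R[G]$. A representation of $G$ on an $R$-module $V$ is a right $R[G]$-comodule structure $\rho:V\to V\otimes_R R[G]$, and an element $v\in V$ is called a semi-invariant if the submodule $Rv\subset V$ is a subrepresentation, i.e. if $\rho(Rv)$ lies in $Rv\otimes_R R[G]$. The group scheme $G$ is called prudent if, for every representation of $G$ on a free $R$-module $V$ of finite rank, each $v\in V$ whose image in the quotient representation $V/\pi^{n+1}V$ is a semi-invariant for all $n\ge 0$ is a semi-invariant of $V$. Theorem. If $G$ is prudent, then the divisible ideal $\mathfrak d(G)=\bigcap_{n\ge 0}\pi^nR[G]$ is zero. If, moreover, the $K$-vector space $K[G]=K\otimes_R R[G]$ has at most countable dimension, then $R[G]$ is a free $R$-module. -/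

import Mathlib

open scoped TensorProduct Pointwise

/-!
Throughout, an affine group scheme `G` over `R` is given by its ring of functions `A = R[G]`,
a commutative Hopf algebra over `R`.
-/

universe u v w

/-- A representation of the affine group scheme `G` with ring of functions `A = R[G]` on the
`R`-module `V`: a right comodule structure `V → V ⊗ R[G]`, coassociative and counital. -/
structure GroupSchemeRep (R : Type u) [CommRing R] (A : Type v) [CommRing A] [HopfAlgebra R A]
    (V : Type w) [AddCommGroup V] [Module R V] where
  /-- The coaction `V → V ⊗ R[G]`. -/
  coact : V →ₗ[R] V ⊗[R] A
  /-- `(ρ ⊗ id) ∘ ρ = (id ⊗ Δ) ∘ ρ`, up to the associativity isomorphism. -/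
  coassoc : (TensorProduct.assoc R V A A).toLinearMap ∘ₗ coact.rTensor A ∘ₗ coact =
    (Coalgebra.comul (R := R) (A := A)).lTensor V ∘ₗ coact
  /-- `(id ⊗ ε) ∘ ρ = id`, up to the isomorphism `V ⊗ R ≃ V`. -/
  counit : (TensorProduct.rid R V).toLinearMap ∘ₗ
    (Coalgebra.counit (R := R) (A := A)).lTensor V ∘ₗ coact = LinearMap.id

namespace GroupSchemeRep

variable {R : Type u} [CommRing R] {A : Type v} [CommRing A] [HopfAlgebra R A]
  {V : Type w} [AddCommGroup V] [Module R V]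

/-- The submodule `N` of `V` is a subrepresentation: the coaction maps `N` into (the image in
`V ⊗ R[G]` of) `N ⊗ R[G]`. -/
def IsSubrep (ρ : GroupSchemeRep R A V) (N : Submodule R V) : Prop :=
  ∀ x ∈ N, ρ.coact x ∈ LinearMap.range (N.subtype.rTensor A)

/-- `v` is a semi-invariant if `R v` is a subrepresentation. -/
def IsSemiInvariant (ρ : GroupSchemeRep R A V) (v : V) : Prop :=
  ρ.IsSubrep (Submodule.span R {v})

theorem IsSubrep.le_ker {ρ : GroupSchemeRep R A V} {N : Submodule R V} (hN : ρ.IsSubrep N) :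
    N ≤ LinearMap.ker (N.mkQ.rTensor A ∘ₗ ρ.coact) := by
  intro x hx
  obtain ⟨t, ht⟩ := hN x hx
  rw [LinearMap.mem_ker, LinearMap.comp_apply, ← ht, ← LinearMap.comp_apply,
    ← LinearMap.rTensor_comp]
  have h0 : N.mkQ ∘ₗ N.subtype = 0 := by
    ext y
    simp
  rw [h0, LinearMap.rTensor_zero, LinearMap.zero_apply]

/-- The quotient representation `V / N` by a subrepresentation `N`: the coaction sends the class
of `x` to the image of `ρ(x)` in `(V / N) ⊗ R[G]`. -/
def quotient (ρ : GroupSchemeRep R A V) (N : Submodule R V) (hN : ρ.IsSubrep N) :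
    GroupSchemeRep R A (V ⧸ N) where
  coact := N.liftQ (N.mkQ.rTensor A ∘ₗ ρ.coact) hN.le_ker
  coassoc := by
    apply Submodule.linearMap_qext
    have key : N.liftQ (N.mkQ.rTensor A ∘ₗ ρ.coact) hN.le_ker ∘ₗ N.mkQ =
        N.mkQ.rTensor A ∘ₗ ρ.coact := Submodule.liftQ_mkQ _ _ _
    have h1 : (TensorProduct.assoc R (V ⧸ N) A A).toLinearMap ∘ₗ
        (N.mkQ.rTensor A).rTensor A =
        N.mkQ.rTensor (A ⊗[R] A) ∘ₗ (TensorProduct.assoc R V A A).toLinearMap := by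
      apply TensorProduct.ext_threefold
      intro x y z
      simp
    rw [LinearMap.comp_assoc, LinearMap.comp_assoc, key, ← LinearMap.comp_assoc (ρ.coact),
      ← LinearMap.rTensor_comp, key, LinearMap.rTensor_comp, LinearMap.comp_assoc,
      ← LinearMap.comp_assoc, h1, LinearMap.comp_assoc, ρ.coassoc, LinearMap.comp_assoc, key,
      ← LinearMap.comp_assoc, ← LinearMap.comp_assoc, LinearMap.rTensor_comp_lTensor,
      LinearMap.lTensor_comp_rTensor]
  counit := by
    apply Submodule.linearMap_qext
    have key : N.liftQ (N.mkQ.rTensor A ∘ₗ ρ.coact) hN.le_ker ∘ₗ N.mkQ =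
        N.mkQ.rTensor A ∘ₗ ρ.coact := Submodule.liftQ_mkQ _ _ _
    have h1 : (TensorProduct.rid R (V ⧸ N)).toLinearMap ∘ₗ N.mkQ.rTensor R =
        N.mkQ ∘ₗ (TensorProduct.rid R V).toLinearMap := by
      apply TensorProduct.ext'
      intro x y
      simp
    rw [LinearMap.comp_assoc, LinearMap.comp_assoc, key,
      ← LinearMap.comp_assoc (ρ.coact), LinearMap.lTensor_comp_rTensor,
      ← LinearMap.rTensor_comp_lTensor, LinearMap.comp_assoc, ← LinearMap.comp_assoc, h1,
      LinearMap.comp_assoc, ρ.counit, LinearMap.comp_id, LinearMap.id_comp]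

/-- For a scalar `c`, the submodule `c V` is a subrepresentation of `V`. -/
theorem isSubrep_smul_top (ρ : GroupSchemeRep R A V) (c : R) :
    ρ.IsSubrep (c • (⊤ : Submodule R V)) := by
  intro x hx
  obtain ⟨y, -, rfl⟩ := (Submodule.mem_smul_pointwise_iff_exists _ _ _).1 hx
  rw [map_smul]
  generalize ρ.coact y = t
  induction t with
  | zero => simp
  | add s t hs ht =>
    rw [smul_add]
    exact Submodule.add_mem _ hs ht
  | tmul z a =>
    exact ⟨⟨c • z, Submodule.smul_mem_pointwise_smul z c ⊤ trivial⟩ ⊗ₜ a, by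
      simp [TensorProduct.smul_tmul']⟩

/-- The representation `V / c V`, the reduction of `V` modulo `c`. -/
def reduction (ρ : GroupSchemeRep R A V) (c : R) :
    GroupSchemeRep R A (V ⧸ (c • (⊤ : Submodule R V))) :=
  ρ.quotient _ (ρ.isSubrep_smul_top c)

/-- The representation `V` is prudent (with respect to the uniformizer `ϖ`) if every `v` in `V`
whose class in `V / ϖ ^ (n + 1) V` is a semi-invariant for all `n` is a semi-invariant. -/
def IsPrudent (ρ : GroupSchemeRep R A V) (ϖ : R) : Prop :=
  ∀ v : V, (∀ n : ℕ, (ρ.reduction (ϖ ^ (n + 1))).IsSemiInvariant (Submodule.Quotient.mk v)) →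
    ρ.IsSemiInvariant v

end GroupSchemeRep

/-- The affine group scheme with ring of functions `A = R[G]` is prudent if each of its
representations on a free `R`-module of finite rank is prudent. (Such a module is isomorphic to
some `Fin r → R`, so that it is enough to let `V` range over the universe of `R`.) -/
def IsPrudentGroupScheme (R : Type u) [CommRing R] (A : Type v) [CommRing A] [HopfAlgebra R A]
    (ϖ : R) : Prop :=
  ∀ (V : Type u) [AddCommGroup V] [Module R V] [Module.Free R V] [Module.Finite R V]
    (ρ : GroupSchemeRep R A V), ρ.IsPrudent ϖ

/-- The divisible ideal `⋂ ϖ ^ n A` of the `R`-algebra `A`. -/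
def divisibleIdeal (R : Type u) [CommRing R] (A : Type v) [CommRing A] [Algebra R A] (ϖ : R) :
    Ideal A :=
  ⨅ n : ℕ, Ideal.span {algebraMap R A (ϖ ^ n)}

/-!
Let `d` be the divisible ideal of `A = R[G]`. Modulo every power of the uniformizer, `A` and `A / d`
agree; so a vector of a `G`-representation of finite rank which is a semi-invariant for the closed
subgroup `H` with functions `A / d` is a semi-invariant modulo every power of the uniformizer, and
prudence makes it a semi-invariant of `G` (`IsPrudentGroupScheme.exists_weight`).

That `H` is a subgroup at all is where completeness enters: the comultiplication sends `d` into the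
divisible part of `(A / d) ⊗ (A / d)`, and this module is separated, because a separated
torsion-free module of finite rank over a complete discrete valuation ring is finitely generated
(`finite_of_rank_lt_aleph0`, `isHausdorff_tensorProduct`).

Given `a ∈ d`, take a finitely generated subcomodule `V` of `A` containing `a`
(`exists_finite_subcomodule`). The saturated submodule `W = V ∩ d` is stable under `H`. Passing to
the line spanned by the antisymmetrized tensor of a basis of `W` in a tensor power of `V`, one finds
that `W` is stable under `G` (`IsPrudentGroupScheme.block_eq_zero`). But evaluation at the identity
vanishes on `d`, and a function is recovered from the values of its translates at the identity, so
`W = 0` and `a = 0`.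

Once `d = 0`, the `R`-module `A` is separated and torsion-free. If its rank is countable, it is an
increasing union of saturated submodules of finite rank, which are finitely generated with free
successive quotients, so that it is free (`free_of_rank_le_aleph0`).
-/

/-! ### Modules over a complete discrete valuation ring -/

section CompleteDVR

variable {R : Type*} [CommRing R] [IsDomain R] [IsDiscreteValuationRing R]

open IsLocalRing

theorem mem_maximalIdeal_pow_smul_top_iff {M : Type*} [AddCommGroup M] [Module R M] {ϖ : R}
    (hϖ : Irreducible ϖ) (n : ℕ) (x : M) :
    x ∈ (maximalIdeal R ^ n • ⊤ : Submodule R M) ↔ ∃ y, ϖ ^ n • y = x := by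
  rw [hϖ.maximalIdeal_eq, Ideal.span_singleton_pow, Submodule.ideal_span_singleton_smul,
    Submodule.mem_smul_pointwise_iff_exists]
  simp

theorem isHausdorff_maximalIdeal_iff {M : Type*} [AddCommGroup M] [Module R M] {ϖ : R}
    (hϖ : Irreducible ϖ) :
    IsHausdorff (maximalIdeal R) M ↔ ∀ x : M, (∀ n : ℕ, ∃ y, ϖ ^ n • y = x) → x = 0 := by
  simp only [isHausdorff_iff, SModEq.zero, mem_maximalIdeal_pow_smul_top_iff hϖ]

theorem eq_zero_of_forall_pow_dvd {ϖ : R} (hϖ : Irreducible ϖ) {x : R}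
    (hx : ∀ n : ℕ, ϖ ^ n ∣ x) : x = 0 :=
  (isHausdorff_maximalIdeal_iff hϖ).1 (inferInstanceAs (IsHausdorff (maximalIdeal R) R)) x
    fun n => by
      obtain ⟨y, hy⟩ := hx n
      exact ⟨y, hy.symm⟩

theorem isHausdorff_submodule {M : Type*} [AddCommGroup M] [Module R M]
    [IsHausdorff (maximalIdeal R) M] (U : Submodule R M) : IsHausdorff (maximalIdeal R) U := by
  obtain ⟨ϖ, hϖ⟩ := IsDiscreteValuationRing.exists_irreducible R
  refine (isHausdorff_maximalIdeal_iff hϖ).2 fun x hx => Subtype.ext ?_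
  refine (isHausdorff_maximalIdeal_iff (M := M) hϖ).1 inferInstance x fun n => ?_
  obtain ⟨y, rfl⟩ := hx n
  exact ⟨y, rfl⟩

theorem isPrecomplete_pi {S : Type*} [CommRing S] (I : Ideal S) [IsPrecomplete I S]
    (ι : Type*) [Finite ι] : IsPrecomplete I (ι → S) := by
  classical
  have := Fintype.ofFinite ι
  refine ⟨fun f hf => ?_⟩
  have key : ∀ i : ι, ∃ L : S, ∀ n, f n i ≡ L [SMOD (I ^ n • ⊤ : Submodule S S)] := fun i => by
    refine IsPrecomplete.prec inferInstance fun {m n} hmn => ?_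
    have := (hf hmn).map (LinearMap.proj i : (ι → S) →ₗ[S] S)
    refine this.mono ?_
    rw [Submodule.map_smul'']
    exact Submodule.smul_mono le_rfl le_top
  choose L hL using key
  refine ⟨L, fun n => ?_⟩
  rw [SModEq.sub_mem, pi_eq_sum_univ' (f n - L)]
  refine Submodule.sum_mem _ fun i _ => ?_
  have := (hL i n).map (LinearMap.single S (fun _ : ι => S) i)
  rw [SModEq.sub_mem, ← map_sub, Submodule.map_smul''] at this
  have h2 := Submodule.smul_mono le_rfl le_top this
  convert h2 using 1
  ext j
  simp [Pi.single_apply, eq_comm]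

/-- Elements of a torsion-free module which form a basis modulo the maximal ideal are linearly
independent: a relation can be divided by the uniformizer indefinitely. -/
theorem linearIndependent_of_basis_mod {M : Type*} [AddCommGroup M] [Module R M]
    [Module.IsTorsionFree R M] {ι : Type*}
    (b : Module.Basis ι (R ⧸ maximalIdeal R) (M ⧸ (maximalIdeal R • ⊤ : Submodule R M)))
    (x : ι → M) (hx : ∀ i, Submodule.Quotient.mk (x i) = b i) : LinearIndependent R x := by
  obtain ⟨ϖ, hϖ⟩ := IsDiscreteValuationRing.exists_irreducible R
  rw [linearIndependent_iff']
  intro s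
  have base : ∀ g : ι → R, ∑ i ∈ s, g i • x i = 0 → ∀ i ∈ s, ϖ ∣ g i := by
    intro g hg i hi
    have h1 : ∑ i ∈ s, (Ideal.Quotient.mk (maximalIdeal R) (g i)) • b i = 0 := by
      have := congrArg (Submodule.mkQ (maximalIdeal R • ⊤ : Submodule R M)) hg
      simpa [map_sum, hx, ← Module.Quotient.mk_smul_mk] using this
    have := linearIndependent_iff'.1 b.linearIndependent s _ h1 i hi
    rw [Ideal.Quotient.eq_zero_iff_mem, hϖ.maximalIdeal_eq, Ideal.mem_span_singleton] at this
    exact this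
  have key : ∀ n : ℕ, ∀ g : ι → R, ∑ i ∈ s, g i • x i = 0 → ∀ i ∈ s, ϖ ^ n ∣ g i := by
    intro n
    induction n with
    | zero => simp
    | succ n ih =>
      intro g hg
      choose! g' hg' using base g hg
      have h2 : ∑ i ∈ s, g' i • x i = 0 := by
        have : ϖ • ∑ i ∈ s, g' i • x i = 0 := by
          rw [Finset.smul_sum, ← hg]
          exact Finset.sum_congr rfl fun i hi => by rw [smul_smul, ← hg' i hi]
        exact (smul_eq_zero.1 this).resolve_left hϖ.ne_zero
      intro i hi
      rw [hg' i hi, pow_succ']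
      exact mul_dvd_mul_left _ (ih g' h2 i hi)
  exact fun g hg i hi => eq_zero_of_forall_pow_dvd hϖ fun n => key n g hg i hi

/-- Over a complete discrete valuation ring, a separated torsion-free module of finite rank is
finitely generated: a basis modulo the maximal ideal is finite, and it generates by
completeness. -/
theorem finite_of_rank_lt_aleph0 [IsAdicComplete (maximalIdeal R) R] {M : Type*} [AddCommGroup M]
    [Module R M] [Module.IsTorsionFree R M] [IsHausdorff (maximalIdeal R) M]
    (h : Module.rank R M < Cardinal.aleph0) : Module.Finite R M := by
  let := Ideal.Quotient.field (maximalIdeal R)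
  let b := Module.Basis.ofVectorSpace (R ⧸ maximalIdeal R)
    (M ⧸ (maximalIdeal R • ⊤ : Submodule R M))
  choose x hx using fun i => Submodule.Quotient.mk_surjective _ (b i)
  have hfin : Finite _ := Cardinal.lt_aleph0_iff_finite.1
    ((linearIndependent_of_basis_mod b x hx).cardinal_le_rank.trans_lt h)
  have := Fintype.ofFinite (Module.Basis.ofVectorSpaceIndex (R ⧸ maximalIdeal R)
    (M ⧸ (maximalIdeal R • ⊤ : Submodule R M)))
  have := isPrecomplete_pi (maximalIdeal R) (Module.Basis.ofVectorSpaceIndex (R ⧸ maximalIdeal R)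
    (M ⧸ (maximalIdeal R • ⊤ : Submodule R M)))
  refine Module.Finite.of_surjective (Fintype.linearCombination R x)
    (surjective_of_mkQ_comp_surjective (I := maximalIdeal R) fun y => ?_)
  choose c hc using fun i => Ideal.Quotient.mk_surjective (b.repr y i)
  refine ⟨c, ?_⟩
  rw [← b.sum_repr y]
  simp [Fintype.linearCombination_apply, hx, ← hc]

end CompleteDVR

/-! ### Saturated submodules -/

section Saturation

variable {R : Type*} [CommRing R] [IsDomain R] {M : Type*} [AddCommGroup M] [Module R M]

/-- The saturation of a submodule `N`: the elements with a nonzero multiple in `N`, that is, the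
preimage of the torsion submodule of `M / N`. -/
def Submodule.torsionClosure (N : Submodule R M) : Submodule R M :=
  (Submodule.torsion R (M ⧸ N)).comap N.mkQ

theorem Submodule.mem_torsionClosure {N : Submodule R M} {x : M} :
    x ∈ N.torsionClosure ↔ ∃ r : R, r ≠ 0 ∧ r • x ∈ N := by
  simp only [torsionClosure, mem_comap, mem_torsion_iff, mkQ_apply,
    Submodule.Quotient.mk_eq_zero, Subtype.exists, mem_nonZeroDivisors_iff_ne_zero,
    Submonoid.smul_def, exists_prop, ← Submodule.Quotient.mk_smul]

theorem Submodule.le_torsionClosure (N : Submodule R M) : N ≤ N.torsionClosure := fun x hx =>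
  mem_torsionClosure.2 ⟨1, one_ne_zero, by simpa⟩

theorem Submodule.torsionClosure_mono {N N' : Submodule R M} (h : N ≤ N') :
    N.torsionClosure ≤ N'.torsionClosure := fun _ hx => by
  obtain ⟨r, hr, hx⟩ := mem_torsionClosure.1 hx
  exact mem_torsionClosure.2 ⟨r, hr, h hx⟩

theorem Submodule.mem_torsionClosure_of_smul_mem {N : Submodule R M} {r : R} (hr : r ≠ 0) {x : M}
    (hx : r • x ∈ N.torsionClosure) : x ∈ N.torsionClosure := by
  obtain ⟨s, hs, hx⟩ := mem_torsionClosure.1 hx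
  exact mem_torsionClosure.2 ⟨s * r, mul_ne_zero hs hr, by rwa [mul_smul]⟩

theorem Submodule.isTorsionFree_quotient_of_smul_mem {N : Submodule R M}
    (h : ∀ (r : R) (x : M), r ≠ 0 → r • x ∈ N → x ∈ N) : Module.IsTorsionFree R (M ⧸ N) := by
  refine .of_smul_eq_zero fun r x hx => ?_
  obtain ⟨x, rfl⟩ := Submodule.Quotient.mk_surjective _ x
  rw [← Submodule.Quotient.mk_smul, Submodule.Quotient.mk_eq_zero] at hx
  rw [Submodule.Quotient.mk_eq_zero]
  exact or_iff_not_imp_left.2 fun hr => h r x hr hx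

instance (N : Submodule R M) : Module.IsTorsionFree R (M ⧸ N.torsionClosure) :=
  Submodule.isTorsionFree_quotient_of_smul_mem fun _ _ hr hx =>
    Submodule.mem_torsionClosure_of_smul_mem hr hx

theorem Submodule.rank_torsionClosure (N : Submodule R M) :
    Module.rank R N.torsionClosure = Module.rank R N := by
  have h0 : Module.rank R (N.torsionClosure ⧸ N.comap N.torsionClosure.subtype) = 0 := by
    rw [rank_eq_zero_iff]
    intro x
    obtain ⟨x, rfl⟩ := Submodule.Quotient.mk_surjective _ x
    obtain ⟨r, hr, hx⟩ := mem_torsionClosure.1 x.2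
    refine ⟨r, hr, ?_⟩
    rw [← Submodule.Quotient.mk_smul, Submodule.Quotient.mk_eq_zero]
    exact hx
  rw [← rank_quotient_add_rank_of_isDomain (N.comap N.torsionClosure.subtype), h0, zero_add]
  exact (Submodule.comapSubtypeEquivOfLe N.le_torsionClosure).rank_eq

end Saturation

/-! ### Tensor products and modules of countable rank over a complete discrete valuation ring -/

section CompleteDVR

open IsLocalRing

variable {R : Type*} [CommRing R] [IsDomain R] [IsDiscreteValuationRing R]
  [IsAdicComplete (maximalIdeal R) R]
  {M : Type*} [AddCommGroup M] [Module R M] [Module.IsTorsionFree R M]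

theorem Submodule.finite_torsionClosure [IsHausdorff (maximalIdeal R) M] (N : Submodule R M)
    [Module.Finite R N] : Module.Finite R N.torsionClosure := by
  have := isHausdorff_submodule N.torsionClosure
  refine finite_of_rank_lt_aleph0 ?_
  rw [N.rank_torsionClosure]
  exact Module.rank_lt_aleph0 R N

/-- The tensor product of two separated torsion-free modules over a complete discrete valuation
ring is separated: an element of `M ⊗ N` comes from `U ⊗ N`, where `U` is saturated in `M` and
finitely generated, hence free; a divisor `y` of it in `M ⊗ N` has torsion image in the
torsion-free module `(M / U) ⊗ N`, so that `y` comes from `U ⊗ N` as well. -/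
theorem isHausdorff_tensorProduct {N : Type*} [AddCommGroup N] [Module R N]
    [Module.IsTorsionFree R N] [IsHausdorff (maximalIdeal R) M] [IsHausdorff (maximalIdeal R) N] :
    IsHausdorff (maximalIdeal R) (M ⊗[R] N) := by
  obtain ⟨ϖ, hϖ⟩ := IsDiscreteValuationRing.exists_irreducible R
  refine (isHausdorff_maximalIdeal_iff hϖ).2 fun x hx => ?_
  obtain ⟨M', hfin, hM'⟩ :=
    TensorProduct.exists_finite_submodule_left_of_setFinite {x} (Set.finite_singleton x)
  have := M'.finite_torsionClosure
  set U := M'.torsionClosure with hU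
  obtain ⟨x', rfl⟩ : ∃ x', U.subtype.rTensor N x' = x := by
    obtain ⟨t, ht⟩ := hM' rfl
    refine ⟨(Submodule.inclusion M'.le_torsionClosure).rTensor N t, ?_⟩
    rw [← ht, ← LinearMap.comp_apply, ← LinearMap.rTensor_comp]
    rfl
  have hinj : Function.Injective (U.subtype.rTensor N) :=
    Module.Flat.rTensor_preserves_injective_linearMap _ U.subtype_injective
  have hex : Function.Exact (U.subtype.rTensor N) (U.mkQ.rTensor N) :=
    rTensor_exact N (LinearMap.exact_subtype_mkQ U) U.mkQ_surjective
  have hx' : ∀ n : ℕ, ∃ y, ϖ ^ n • y = x' := fun n => by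
    obtain ⟨y, hy⟩ := hx n
    have hy0 : U.mkQ.rTensor N y = 0 := by
      have : ϖ ^ n • U.mkQ.rTensor N y = 0 := by
        rw [← map_smul, hy]
        exact hex.apply_apply_eq_zero x'
      exact (smul_eq_zero.1 this).resolve_left (pow_ne_zero _ hϖ.ne_zero)
    obtain ⟨y', rfl⟩ := (hex y).1 hy0
    exact ⟨y', hinj (by rw [map_smul, hy])⟩
  let b := Module.Free.chooseBasis R U
  suffices x' = 0 by rw [this, map_zero]
  apply (TensorProduct.equivFinsuppOfBasisLeft b).injective
  rw [map_zero]
  ext i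
  refine (isHausdorff_maximalIdeal_iff (M := N) hϖ).1 inferInstance _ fun n => ?_
  obtain ⟨y, rfl⟩ := hx' n
  exact ⟨TensorProduct.equivFinsuppOfBasisLeft b y i, by rw [map_smul]; rfl⟩

/-- A separated torsion-free module of countable rank over a complete discrete valuation ring is
free. It is the union of an increasing sequence of saturated submodules of finite rank; these are
finitely generated, so that the successive quotients are free, and lifts of their bases form a
basis. -/
theorem free_of_rank_le_aleph0 [IsHausdorff (maximalIdeal R) M]
    (h : Module.rank R M ≤ Cardinal.aleph0) : Module.Free R M := by
  classical
  -- A maximal linearly independent family; it is countable, but it need not span `M`.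
  obtain ⟨s, hs, hmax⟩ := exists_maximal_linearIndepOn R (id : M → M)
  have hcount : s.Countable := Cardinal.mk_le_aleph0_iff.1 (hs.cardinal_le_rank.trans h)
  obtain ⟨e, he⟩ : ∃ e : ℕ → M, s ⊆ Set.range e := by
    rcases s.eq_empty_or_nonempty with rfl | hne
    · exact ⟨0, Set.empty_subset _⟩
    · obtain ⟨e, he⟩ := hcount.exists_eq_range hne
      exact ⟨e, he.le⟩
  let N : ℕ → Submodule R M := fun n => Submodule.span R (e '' Set.Iio n)
  have hNmono : Monotone N := fun m n hmn =>
    Submodule.span_mono (Set.image_mono (Set.Iio_subset_Iio hmn))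
  have hNfin : ∀ n, Module.Finite R (N n) := fun n =>
    Module.Finite.span_of_finite R ((Set.finite_Iio n).image e)
  let F : ℕ → Submodule R M := fun n => (N n).torsionClosure
  have hFmono : Monotone F := fun m n hmn => Submodule.torsionClosure_mono (hNmono hmn)
  have hFfin : ∀ n, Module.Finite R (F n) := fun n => (N n).finite_torsionClosure
  have hF0 : F 0 = ⊥ := by
    refine (Submodule.eq_bot_iff _).2 fun x hx => ?_
    obtain ⟨r, hr, hx⟩ := Submodule.mem_torsionClosure.1 hx
    simp only [N, Set.Iio_zero_eq_empty, Set.image_empty, Submodule.span_empty,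
      Submodule.mem_bot] at hx
    exact (smul_eq_zero.1 hx).resolve_left hr
  have hFtop : ∀ x, ∃ n, x ∈ F n := fun x => by
    obtain ⟨r, hr, hx⟩ : ∃ r : R, r ≠ 0 ∧ r • x ∈ Submodule.span R (Set.range e) := by
      by_cases hxs : x ∈ s
      · exact ⟨1, one_ne_zero, by simpa using Submodule.subset_span (he hxs)⟩
      · obtain ⟨r, hr, hx⟩ := hmax x hxs
        exact ⟨r, hr, Submodule.span_mono (by simpa using he) hx⟩
    have hU : Submodule.span R (Set.range e) = ⨆ n, N n := by
      rw [← Submodule.span_iUnion, ← Set.image_iUnion, Set.iUnion_Iio, Set.image_univ]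
    rw [hU, Submodule.mem_iSup_of_directed _ hNmono.directed_le] at hx
    obtain ⟨n, hn⟩ := hx
    exact ⟨n, Submodule.mem_torsionClosure.2 ⟨r, hr, hn⟩⟩
  -- Lifts `t n` of a basis of `F (n + 1) / F n`, a finitely generated torsion-free module.
  have step : ∀ n, ∃ t : Set M, t ⊆ F (n + 1) ∧ LinearIndepOn R (F n).mkQ t ∧
      F (n + 1) ≤ F n ⊔ Submodule.span R t := fun n => by
    have : Module.Finite R ((F (n + 1)).map (F n).mkQ) := inferInstance
    let b := Module.Free.chooseBasis R ((F (n + 1)).map (F n).mkQ)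
    choose x hx hxb using fun i => Submodule.mem_map.1 (b i).2
    have hli : LinearIndependent R ((F n).mkQ ∘ x) := by
      have := b.linearIndependent.map' ((F (n + 1)).map (F n).mkQ).subtype
        (Submodule.ker_subtype _)
      rwa [show (F n).mkQ ∘ x = ((F (n + 1)).map (F n).mkQ).subtype ∘ b from funext hxb]
    refine ⟨Set.range x, Set.range_subset_iff.2 hx, ?_, fun y hy => ?_⟩
    · exact (linearIndepOn_range_iff hli.injective.of_comp _).2 hli
    · have h1 : (F n).mkQ y ∈ (Submodule.span R (Set.range x)).map (F n).mkQ := by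
        rw [show (F n).mkQ y = _ from (congrArg Subtype.val
          (b.sum_repr ⟨(F n).mkQ y, Submodule.mem_map_of_mem hy⟩)).symm]
        simp only [Submodule.coe_sum, Submodule.coe_smul, ← hxb, ← map_smul, ← map_sum]
        exact Submodule.mem_map_of_mem (Submodule.sum_mem _ fun i _ =>
          Submodule.smul_mem _ _ (Submodule.subset_span ⟨i, rfl⟩))
      obtain ⟨z, hz, hzy⟩ := Submodule.mem_map.1 h1
      refine Submodule.mem_sup.2 ⟨y - z, ?_, z, hz, sub_add_cancel _ _⟩
      rw [← Submodule.ker_mkQ (F n), LinearMap.mem_ker, map_sub, hzy, sub_self]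
  choose t htF htli htspan using step
  let S : ℕ → Set M := fun n => ⋃ m < n, t m
  have hSmono : Monotone S := fun m n hmn =>
    Set.biUnion_subset_biUnion_left fun k hk => lt_of_lt_of_le hk hmn
  have hSsucc : ∀ n, S (n + 1) = S n ∪ t n := fun n => Set.biUnion_lt_succ t n
  have hSF : ∀ n, S n ⊆ F n := fun n =>
    Set.iUnion₂_subset fun m hm => (htF m).trans (hFmono hm)
  have hSspan : ∀ n, F n ≤ Submodule.span R (S n) := fun n => by
    induction n with
    | zero => rw [hF0]; exact bot_le
    | succ n ih =>
      rw [hSsucc, Submodule.span_union]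
      exact (htspan n).trans (sup_le_sup_right ih _)
  have hSli : ∀ n, LinearIndepOn R id (S n) := fun n => by
    induction n with
    | zero => simp [S]
    | succ n ih =>
      rw [hSsucc]
      exact LinearIndepOn.union_id_of_quotient (hSF n) ih (htli n)
  have hli : LinearIndepOn R id (⋃ n, S n) :=
    linearIndepOn_iUnion_of_directed hSmono.directed_le hSli
  refine Module.Free.of_basis (Module.Basis.mk hli fun x _ => ?_)
  obtain ⟨n, hn⟩ := hFtop x
  have := Submodule.span_mono (Set.subset_iUnion S n) (hSspan n hn)
  rwa [← Set.image_eq_range, Set.image_id]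

end CompleteDVR

/-! ### Determinants and linear independence in tensor products -/

section LinearAlgebra

/-- The first half of the Cauchy–Binet formula, summed over all maps `J` instead of the increasing
ones. -/
theorem Matrix.det_mul_eq_sum_prod_mul_det {S ι n : Type*} [CommRing S] [Fintype ι] [DecidableEq ι]
    [Fintype n] (X : Matrix ι n S) (Y : Matrix n ι S) :
    (X * Y).det = ∑ J : ι → n, (∏ k, X k (J k)) * (Y.submatrix J id).det := by
  have h := (Matrix.detRowAlternating (n := ι) (R := S)).toMultilinearMap.map_sum
    (fun (k : ι) (m : n) => X k m • Y m)
  have h2 : X * Y = fun k => ∑ m, X k m • Y m := by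
    ext k j
    simp [Matrix.mul_apply]
  refine (congrArg Matrix.det h2).trans (h.trans (Finset.sum_congr rfl fun J _ => ?_))
  rw [MultilinearMap.map_smul_univ]
  rfl

theorem LinearIndependent.eq_of_sum_tmul_eq {R M N ι : Type*} [CommRing R] [AddCommGroup M]
    [Module R M] [AddCommGroup N] [Module R N] [Module.Flat R N] [Fintype ι] {b : ι → M}
    (hb : LinearIndependent R b) {x y : ι → N} (h : ∑ i, b i ⊗ₜ[R] x i = ∑ i, b i ⊗ₜ[R] y i) :
    x = y := by
  classical
  have hinj := Module.Flat.rTensor_preserves_injective_linearMap (M := N)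
    (Fintype.linearCombination R b) (linearIndependent_iff_injective_fintypeLinearCombination.1 hb)
  have h2 : ∑ i, (Pi.single i 1 : ι → R) ⊗ₜ[R] x i = ∑ i, (Pi.single i 1 : ι → R) ⊗ₜ[R] y i :=
    hinj (by simpa [map_sum, Fintype.linearCombination_apply_single] using h)
  ext i
  simpa [map_sum, Pi.single_apply] using
    congrArg (TensorProduct.lid R N ∘ (LinearMap.proj i : (ι → R) →ₗ[R] R).rTensor N) h2

end LinearAlgebra

/-! ### Representations given by matrix coefficients, and their semi-invariants -/

section Comatrix

variable {R : Type u} [CommRing R] {A : Type v} [CommRing A]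

/-- A matrix with entries in a bialgebra is multiplicative if `Δ(c i j) = ∑ k, c i k ⊗ c k j` and
`ε(c i j) = δ i j`: such matrices are the matrix coefficients of the representations on free
modules of finite rank. -/
structure Matrix.IsMultiplicative (R : Type u) [CommRing R] {A : Type v} [CommRing A]
    [Bialgebra R A] {I : Type*} [Fintype I] [DecidableEq I] (c : Matrix I I A) : Prop where
  comul_apply : ∀ i j, Coalgebra.comul (R := R) (c i j) = ∑ k, c i k ⊗ₜ[R] c k j
  counit_apply : ∀ i j, Coalgebra.counit (R := R) (c i j) = (1 : Matrix I I R) i j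

namespace Matrix.IsMultiplicative

/-- The matrix coefficients of the tensor power of a representation are products of its matrix
coefficients. -/
theorem tensorPower [Bialgebra R A] {I : Type*} [Fintype I] [DecidableEq I] {c : Matrix I I A}
    (hc : c.IsMultiplicative R) (ι : Type*) [Fintype ι] [DecidableEq ι] :
    IsMultiplicative R (Matrix.of fun f g : ι → I => ∏ k, c (f k) (g k)) where
  comul_apply f g := by
    have tmul_prod : ∀ (f g : ι → A), ∏ k, (f k ⊗ₜ[R] g k) = (∏ k, f k) ⊗ₜ[R] (∏ k, g k) := by
      intro f g
      induction (Finset.univ : Finset ι) using Finset.induction_on with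
      | empty => rfl
      | insert a s ha ih =>
        simp only [Finset.prod_insert ha, ih, Algebra.TensorProduct.tmul_mul_tmul]
    simp only [Matrix.of_apply]
    rw [← Bialgebra.comulAlgHom_apply, map_prod]
    simp only [Bialgebra.comulAlgHom_apply, hc.comul_apply, ← tmul_prod]
    rw [Finset.prod_univ_sum, Fintype.piFinset_univ]
  counit_apply f g := by
    simp only [Matrix.of_apply]
    rw [← Bialgebra.counitAlgHom_apply, map_prod]
    simp only [Bialgebra.counitAlgHom_apply, hc.counit_apply, Matrix.one_apply,
      Finset.prod_ite_zero, funext_iff]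
    simp

variable [HopfAlgebra R A] {I : Type*} [Fintype I] [DecidableEq I] {c : Matrix I I A}

/-- The representation on `I → R` with matrix coefficients `c`. -/
noncomputable def rep (hc : c.IsMultiplicative R) : GroupSchemeRep R A (I → R) where
  coact := (Pi.basisFun R I).constr R fun j => ∑ i, (Pi.single i 1 : I → R) ⊗ₜ[R] c i j
  coassoc := by
    refine (Pi.basisFun R I).ext fun j => ?_
    simp only [LinearMap.comp_apply, Module.Basis.constr_basis, map_sum, LinearMap.rTensor_tmul,
      LinearMap.lTensor_tmul, hc.comul_apply, TensorProduct.tmul_sum]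
    simp only [← Pi.basisFun_apply, Module.Basis.constr_basis, TensorProduct.sum_tmul, map_sum]
    simp only [LinearEquiv.coe_coe, TensorProduct.assoc_tmul]
    exact Finset.sum_comm
  counit := by
    refine (Pi.basisFun R I).ext fun j => ?_
    simp [hc.counit_apply, Matrix.one_apply]

theorem rep_coact (hc : c.IsMultiplicative R) (v : I → R) :
    hc.rep.coact v = ∑ i, (Pi.single i 1 : I → R) ⊗ₜ[R] ∑ j, v j • c i j := by
  simp only [rep, Module.Basis.constr_apply_fintype, Pi.basisFun_equivFun, LinearEquiv.refl_apply,
    Finset.smul_sum, TensorProduct.tmul_sum, TensorProduct.tmul_smul]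
  exact Finset.sum_comm

end Matrix.IsMultiplicative

theorem sum_single_tmul {R M I : Type*} [CommRing R] [AddCommGroup M] [Module R M] [Fintype I]
    [DecidableEq I] (v : I → R) (t : M) :
    ∑ i, (Pi.single i 1 : I → R) ⊗ₜ[R] (v i • t) = v ⊗ₜ t := by
  simp only [← TensorProduct.smul_tmul, ← TensorProduct.sum_tmul]
  congr 1
  simpa using (pi_eq_sum_univ' v).symm

namespace GroupSchemeRep

variable [HopfAlgebra R A] {V : Type w} [AddCommGroup V] [Module R V]

theorem isSemiInvariant_of_coact_eq {ρ : GroupSchemeRep R A V} {x : V} {t : A}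
    (h : ρ.coact x = x ⊗ₜ t) : ρ.IsSemiInvariant x := by
  intro y hy
  obtain ⟨r, rfl⟩ := Submodule.mem_span_singleton.1 hy
  exact ⟨⟨r • x, hy⟩ ⊗ₜ t, by simp [h, TensorProduct.smul_tmul']⟩

theorem IsSemiInvariant.exists_coact_eq {ρ : GroupSchemeRep R A V} {x : V}
    (h : ρ.IsSemiInvariant x) : ∃ t : A, ρ.coact x = x ⊗ₜ t := by
  obtain ⟨s, hs⟩ := h x (Submodule.mem_span_singleton_self x)
  rw [← hs]
  generalize s = s
  induction s with
  | zero => exact ⟨0, by simp⟩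
  | add s s' hs hs' =>
    obtain ⟨t, ht⟩ := hs
    obtain ⟨t', ht'⟩ := hs'
    exact ⟨t + t', by rw [map_add, ht, ht', TensorProduct.tmul_add]⟩
  | tmul y a =>
    obtain ⟨r, hr⟩ := Submodule.mem_span_singleton.1 y.2
    exact ⟨r • a, by simp [← hr, TensorProduct.smul_tmul]⟩

theorem reduction_coact (ρ : GroupSchemeRep R A V) (c : R) (x : V) :
    (ρ.reduction c).coact (Submodule.Quotient.mk x) =
      (c • (⊤ : Submodule R V)).mkQ.rTensor A (ρ.coact x) := rfl

end GroupSchemeRep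

/-- For a prudent group scheme, a vector which is a semi-invariant with weight `t` modulo the
divisible part of `A` is a semi-invariant. -/
theorem IsPrudentGroupScheme.exists_weight [HopfAlgebra R A] {ϖ : R}
    (hG : IsPrudentGroupScheme R A ϖ) {I : Type} [Fintype I] [DecidableEq I] {c : Matrix I I A}
    (hc : c.IsMultiplicative R) (x : I → R) (t : A)
    (h : ∀ i, ∀ n : ℕ, ∃ a, ϖ ^ n • a = ∑ j, x j • c i j - x i • t) :
    ∃ t' : A, ∀ i, ∑ j, x j • c i j = x i • t' := by
  have key : hc.rep.IsSemiInvariant x := by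
    refine hG (I → R) hc.rep x fun n => GroupSchemeRep.isSemiInvariant_of_coact_eq (t := t) ?_
    choose a ha using fun i => h i (n + 1)
    set N := ϖ ^ (n + 1) • (⊤ : Submodule R (I → R))
    have h0 : ∀ y : I → R, (Submodule.Quotient.mk (ϖ ^ (n + 1) • y) : (I → R) ⧸ N) = 0 :=
        fun y => by
      rw [Submodule.Quotient.mk_eq_zero]
      exact Submodule.smul_mem_pointwise_smul y _ ⊤ trivial
    have h1 : hc.rep.coact x = x ⊗ₜ t + ∑ i, (Pi.single i 1 : I → R) ⊗ₜ (ϖ ^ (n + 1) • a i) := by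
      rw [hc.rep_coact, ← sum_single_tmul x t, ← Finset.sum_add_distrib]
      refine Finset.sum_congr rfl fun i _ => ?_
      rw [← TensorProduct.tmul_add, ha, add_sub_cancel]
    rw [GroupSchemeRep.reduction_coact, h1, map_add, map_sum]
    simp only [LinearMap.rTensor_tmul, ← TensorProduct.smul_tmul, Submodule.mkQ_apply]
    rw [Finset.sum_eq_zero fun i _ => by rw [h0, TensorProduct.zero_tmul], add_zero]
  obtain ⟨t', ht'⟩ := key.exists_coact_eq
  refine ⟨t', fun i => ?_⟩
  rw [hc.rep_coact] at ht'
  simpa [map_sum, Pi.single_apply] using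
    congrArg (TensorProduct.lid R A ∘ (LinearMap.proj i : (I → R) →ₗ[R] R).rTensor A) ht'

end Comatrix

/-! ### Finitely generated subcomodules of a bialgebra -/

section Subcomodule

variable {R : Type u} [CommRing R] {A : Type v} [CommRing A] [Bialgebra R A]

/-- Every element of a flat coalgebra over a Noetherian ring lies in a finitely generated right
subcomodule: if `Δ(a)` lies in `N ⊗ A`, then `{x | Δ(x) ∈ N ⊗ A}` is a subcomodule, and it is
contained in `N` by the counit axiom. -/
theorem exists_finite_subcomodule [IsNoetherianRing R] [Module.Flat R A] (a : A) :
    ∃ V : Submodule R A, Module.Finite R V ∧ a ∈ V ∧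
      ∀ x ∈ V, Coalgebra.comul (R := R) x ∈ LinearMap.range (V.subtype.rTensor A) := by
  obtain ⟨N, hN, ha⟩ := TensorProduct.exists_finite_submodule_left_of_setFinite
    {Coalgebra.comul (R := R) a} (Set.finite_singleton _)
  let g : A →ₗ[R] (A ⧸ N) ⊗[R] A := N.mkQ.rTensor A ∘ₗ Coalgebra.comul
  have hex : Function.Exact (N.subtype.rTensor A) (N.mkQ.rTensor A) :=
    rTensor_exact A (LinearMap.exact_subtype_mkQ N) N.mkQ_surjective
  have hVN : LinearMap.ker g ≤ N := fun x hx => by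
    obtain ⟨t, ht⟩ := (hex _).1 (LinearMap.mem_ker.1 hx)
    have h1 : (TensorProduct.rid R A) ((Coalgebra.counit (R := R) (A := A)).lTensor A
        (Coalgebra.comul x)) = x := by
      rw [Coalgebra.lTensor_counit_comul]
      simp
    rw [← h1, ← ht]
    generalize t = t
    induction t with
    | zero => simp
    | add s t hs ht =>
      simp only [map_add]
      exact N.add_mem hs ht
    | tmul y z => simpa using N.smul_mem _ y.2
  refine ⟨LinearMap.ker g, ?_, ?_, fun x hx => ?_⟩
  · have : IsNoetherian R N := inferInstance
    exact Module.Finite.of_injective (Submodule.inclusion hVN) (Submodule.inclusion_injective hVN)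
  · obtain ⟨t, ht⟩ := ha rfl
    exact LinearMap.mem_ker.2 ((hex _).2 ⟨t, ht⟩)
  · have hex' := Module.Flat.rTensor_exact A (LinearMap.exact_subtype_ker_map g)
    refine (hex' _).1 ?_
    have h1 : ∀ y : A ⊗[R] A, TensorProduct.assoc R (A ⧸ N) A A
        ((N.mkQ.rTensor A).rTensor A ((Coalgebra.comul (R := R) (A := A)).rTensor A y)) =
        N.mkQ.rTensor (A ⊗[R] A)
          (TensorProduct.assoc R A A A ((Coalgebra.comul (R := R) (A := A)).rTensor A y)) := by
      intro y
      generalize (Coalgebra.comul (R := R) (A := A)).rTensor A y = z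
      have : (TensorProduct.assoc R (A ⧸ N) A A).toLinearMap ∘ₗ (N.mkQ.rTensor A).rTensor A =
          N.mkQ.rTensor (A ⊗[R] A) ∘ₗ (TensorProduct.assoc R A A A).toLinearMap :=
        TensorProduct.ext_threefold fun x y z => by simp
      exact LinearMap.congr_fun this z
    apply (TensorProduct.assoc R (A ⧸ N) A A).injective
    rw [map_zero, LinearMap.rTensor_comp, LinearMap.comp_apply, h1, Coalgebra.coassoc_apply,
      ← LinearMap.comp_apply, LinearMap.rTensor_comp_lTensor, ← LinearMap.lTensor_comp_rTensor,
      LinearMap.comp_apply]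
    rw [show N.mkQ.rTensor A (Coalgebra.comul x) = 0 from hx, map_zero]

/-- The matrix coefficients of a right subcomodule of a flat bialgebra with basis `b` form a
multiplicative matrix. -/
theorem Matrix.IsMultiplicative.of_linearIndependent [Module.Flat R A] {I : Type*} [Fintype I]
    [DecidableEq I] {b : I → A} (hb : LinearIndependent R b) {c : Matrix I I A}
    (hc : ∀ j, Coalgebra.comul (R := R) (b j) = ∑ i, b i ⊗ₜ[R] c i j) :
    c.IsMultiplicative R where
  comul_apply i j := by
    refine congrFun (hb.eq_of_sum_tmul_eq (x := fun i => Coalgebra.comul (R := R) (c i j))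
      (y := fun i => ∑ k, c i k ⊗ₜ[R] c k j) ?_) i
    have h := Coalgebra.coassoc_apply (R := R) (b j)
    simp only [hc, map_sum, LinearMap.rTensor_tmul, LinearMap.lTensor_tmul, TensorProduct.sum_tmul,
      TensorProduct.assoc_tmul] at h
    rw [← h, Finset.sum_comm]
    simp only [TensorProduct.tmul_sum]
  counit_apply i j := by
    have h := congrArg (TensorProduct.rid R A) (Coalgebra.lTensor_counit_comul (R := R) (b j))
    simp only [hc, map_sum, LinearMap.lTensor_tmul, TensorProduct.rid_tmul, one_smul] at h
    have h2 : ∑ i, Coalgebra.counit (R := R) (c i j) • b i =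
        ∑ i, (1 : Matrix I I R) i j • b i := by
      rw [h]
      simp [Matrix.one_apply]
    have := Fintype.linearIndependent_iff.1 hb
      (fun i => Coalgebra.counit (R := R) (c i j) - (1 : Matrix I I R) i j)
      (by simp only [sub_smul, Finset.sum_sub_distrib, h2, sub_self]) i
    exact sub_eq_zero.1 this

theorem Submodule.exists_eq_sum_tmul {M N : Type*} [AddCommGroup M] [Module R M] [AddCommGroup N]
    [Module R N] {V : Submodule R M} {I : Type*} [Fintype I] (b : Module.Basis I R V)
    {x : M ⊗[R] N} (hx : x ∈ LinearMap.range (V.subtype.rTensor N)) :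
    ∃ c : I → N, x = ∑ i, (b i : M) ⊗ₜ c i := by
  classical
  obtain ⟨t, rfl⟩ := hx
  refine ⟨TensorProduct.equivFinsuppOfBasisLeft b t, ?_⟩
  conv_lhs => rw [← (TensorProduct.equivFinsuppOfBasisLeft b).symm_apply_apply t,
    TensorProduct.equivFinsuppOfBasisLeft_symm_apply, Finsupp.sum_fintype _ _ (by simp)]
  simp [map_sum]

end Subcomodule

/-- If `N / D` is torsion-free, a finitely generated torsion-free module `V` mapping to `N` over a
principal ideal domain has a basis which extends a basis of the preimage of `D`. -/
theorem Submodule.exists_basis_adapted {R : Type*} [CommRing R] [IsDomain R]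
    [IsPrincipalIdealRing R] {V N : Type*} [AddCommGroup V] [Module R V] [AddCommGroup N]
    [Module R N] [Module.Finite R V] [Module.IsTorsionFree R V] (f : V →ₗ[R] N)
    (D : Submodule R N) [Module.IsTorsionFree R (N ⧸ D)] :
    ∃ (r s : ℕ) (b : Module.Basis (Fin r ⊕ Fin s) R V), (∀ i, f (b (Sum.inl i)) ∈ D) ∧
      LinearIndependent R (fun i => D.mkQ (f (b (Sum.inr i)))) ∧
      ∀ x, f x ∈ D → x ∈ Submodule.span R (Set.range fun i => b (Sum.inl i)) := by
  let W : Submodule R V := D.comap f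
  let φ : (V ⧸ W) →ₗ[R] N ⧸ D := W.mapQ D f le_rfl
  have hφ : LinearMap.ker φ = ⊥ := by
    rw [Submodule.ker_mapQ]
    exact Submodule.mkQ_map_self W
  have : Module.IsTorsionFree R (V ⧸ W) :=
    Function.Injective.moduleIsTorsionFree φ (LinearMap.ker_eq_bot.1 hφ) (fun r x => map_smul φ r x)
  let bW := Module.finBasis R W
  let bQ := Module.finBasis R (V ⧸ W)
  refine ⟨_, _, bW.sumQuot bQ, fun i => ?_, ?_, fun x hx => ?_⟩
  · rw [Module.Basis.sumQuot_inl]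
    exact (bW i).2
  · have h := bQ.linearIndependent.map' φ hφ
    rwa [show φ ∘ bQ = fun i => D.mkQ (f (bW.sumQuot bQ (Sum.inr i))) from funext fun i => by
      rw [Function.comp_apply, ← Module.Basis.sumQuot_inr bW bQ i]
      rfl] at h
  · have h := congrArg Subtype.val (bW.sum_repr ⟨x, hx⟩)
    rw [show x = _ from h.symm, Submodule.coe_sum]
    refine Submodule.sum_mem _ fun i _ => ?_
    rw [Submodule.coe_smul, ← Module.Basis.sumQuot_inl bW bQ i]
    exact Submodule.smul_mem _ _ (Submodule.subset_span ⟨i, rfl⟩)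

/-! ### The divisible ideal -/

section Divisible

variable {R : Type u} [CommRing R] {A : Type v} [CommRing A]

theorem mem_divisibleIdeal_iff [Algebra R A] {ϖ : R} {a : A} :
    a ∈ divisibleIdeal R A ϖ ↔ ∀ n : ℕ, ∃ y : A, ϖ ^ n • y = a := by
  simp only [divisibleIdeal, Ideal.mem_iInf, Ideal.mem_span_singleton', Algebra.smul_def,
    mul_comm (algebraMap R A _)]

open IsLocalRing

variable [IsDomain R] [IsDiscreteValuationRing R] {ϖ : R}

theorem isHausdorff_quotient_divisibleIdeal [Algebra R A] (hϖ : Irreducible ϖ) :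
    IsHausdorff (maximalIdeal R) (A ⧸ (divisibleIdeal R A ϖ).restrictScalars R) := by
  refine (isHausdorff_maximalIdeal_iff hϖ).2 fun x hx => ?_
  obtain ⟨x, rfl⟩ := Submodule.Quotient.mk_surjective _ x
  rw [Submodule.Quotient.mk_eq_zero, Submodule.restrictScalars_mem, mem_divisibleIdeal_iff]
  intro n
  obtain ⟨y, hy⟩ := hx n
  obtain ⟨y, rfl⟩ := Submodule.Quotient.mk_surjective _ y
  rw [← Submodule.Quotient.mk_smul, eq_comm, Submodule.Quotient.eq,
    Submodule.restrictScalars_mem, mem_divisibleIdeal_iff] at hy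
  obtain ⟨z, hz⟩ := hy n
  exact ⟨z + y, by rw [smul_add, hz, sub_add_cancel]⟩

theorem isTorsionFree_quotient_divisibleIdeal [Algebra R A] [Module.IsTorsionFree R A]
    (hϖ : Irreducible ϖ) :
    Module.IsTorsionFree R (A ⧸ (divisibleIdeal R A ϖ).restrictScalars R) := by
  refine Submodule.isTorsionFree_quotient_of_smul_mem fun r x hr hx => ?_
  obtain ⟨m, u, rfl⟩ := IsDiscreteValuationRing.eq_unit_mul_pow_irreducible hr hϖ
  rw [Submodule.restrictScalars_mem, mem_divisibleIdeal_iff] at hx ⊢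
  intro n
  obtain ⟨y, hy⟩ := hx (m + n)
  refine ⟨(↑u⁻¹ : R) • y, smul_right_injective A hr ?_⟩
  simp only
  rw [← hy, smul_smul, smul_smul]
  congr 1
  rw [pow_add]
  linear_combination (ϖ ^ m * ϖ ^ n) * u.mul_inv

theorem counit_eq_zero_of_mem_divisibleIdeal [Bialgebra R A] (hϖ : Irreducible ϖ) {a : A}
    (ha : a ∈ divisibleIdeal R A ϖ) : Coalgebra.counit (R := R) a = 0 := by
  refine eq_zero_of_forall_pow_dvd hϖ fun n => ?_
  obtain ⟨y, rfl⟩ := mem_divisibleIdeal_iff.1 ha n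
  exact ⟨Coalgebra.counit (R := R) y, by simp⟩

/-- The comultiplication maps the divisible ideal `d` to zero in `(A / d) ⊗ (A / d)`, because the
latter is separated. -/
theorem map_mkQ_comul_eq_zero [IsAdicComplete (maximalIdeal R) R] [Bialgebra R A]
    [Module.Flat R A] (hϖ : Irreducible ϖ) {a : A} (ha : a ∈ divisibleIdeal R A ϖ) :
    TensorProduct.map ((divisibleIdeal R A ϖ).restrictScalars R).mkQ
      ((divisibleIdeal R A ϖ).restrictScalars R).mkQ (Coalgebra.comul (R := R) a) = 0 := by
  have := isHausdorff_quotient_divisibleIdeal (A := A) hϖ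
  have := isTorsionFree_quotient_divisibleIdeal (A := A) hϖ
  refine (isHausdorff_maximalIdeal_iff hϖ).1 isHausdorff_tensorProduct _ fun n => ?_
  obtain ⟨y, rfl⟩ := mem_divisibleIdeal_iff.1 ha n
  exact ⟨TensorProduct.map ((divisibleIdeal R A ϖ).restrictScalars R).mkQ
    ((divisibleIdeal R A ϖ).restrictScalars R).mkQ (Coalgebra.comul (R := R) y), by simp⟩

end Divisible

/-! ### Prudence and the divisible ideal -/

section Prudent

open Matrix

/-- If the first `r` basis vectors of a representation `V` span a submodule `W` which is stable
modulo the divisible ideal `d`, then `W` is stable. This is the usual passage from `W` to the line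
`Λ ^ r W`, with the tensor power `V ^ ⊗ r` in the place of `Λ ^ r V`: the antisymmetrization `x` of
`w₁ ⊗ ⋯ ⊗ wᵣ` is a semi-invariant of weight `det h` modulo `d`, where `h` is the upper left block of
`c`, hence a semi-invariant by prudence. Then `det h` is group-like, so a unit, and comparing
coefficients gives the vanishing of the lower left block by Cramer's rule. -/
theorem IsPrudentGroupScheme.block_eq_zero {R : Type u} [CommRing R] {A : Type v} [CommRing A]
    [HopfAlgebra R A] {ϖ : R} (hG : IsPrudentGroupScheme R A ϖ) {r : ℕ} {κ : Type} [Fintype κ]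
    [DecidableEq κ] {c : Matrix (Fin r ⊕ κ) (Fin r ⊕ κ) A} (hc : c.IsMultiplicative R)
    (hd : ∀ i j, c (Sum.inr i) (Sum.inl j) ∈ divisibleIdeal R A ϖ) (i : κ) (j : Fin r) :
    c (Sum.inr i) (Sum.inl j) = 0 := by
  -- `x f` is the coefficient of the antisymmetrized tensor at `e (f 1) ⊗ ⋯ ⊗ e (f r)`.
  let P : (Fin r → Fin r ⊕ κ) → Matrix (Fin r) (Fin r) R := fun f =>
    (1 : Matrix (Fin r ⊕ κ) (Fin r ⊕ κ) R).submatrix f Sum.inl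
  let x : (Fin r → Fin r ⊕ κ) → R := fun f => (P f).det
  let h : Matrix (Fin r) (Fin r) A := c.submatrix Sum.inl Sum.inl
  have hC := hc.tensorPower (Fin r)
  have hb : ∀ f, ∑ g, x g • (Matrix.of fun f g : Fin r → Fin r ⊕ κ => ∏ k, c (f k) (g k)) f g =
      (c.submatrix f Sum.inl).det := fun f => by
    have h1 : c.submatrix f Sum.inl = c.submatrix f id *
        (1 : Matrix (Fin r ⊕ κ) (Fin r ⊕ κ) A).submatrix id Sum.inl := by
      rw [← Matrix.submatrix_mul _ _ _ _ _ Function.bijective_id, Matrix.mul_one]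
    rw [h1, Matrix.det_mul_eq_sum_prod_mul_det]
    refine Finset.sum_congr rfl fun g _ => ?_
    rw [Algebra.smul_def, mul_comm]
    congr 1
    rw [RingHom.map_det]
    congr 1
    ext k l
    by_cases hkl : g k = Sum.inl l <;> simp [P, hkl, Matrix.one_apply]
  -- Modulo `d`, the first `r` columns of `c` are `h` on top of zero.
  have hcong : ∀ f, (c.submatrix f Sum.inl).det - x f • h.det ∈ divisibleIdeal R A ϖ := by
    intro f
    rw [← Ideal.Quotient.eq, Algebra.smul_def, RingHom.map_det (algebraMap R A), ← det_mul,
      RingHom.map_det, RingHom.map_det]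
    congr 1
    ext k l
    rcases hf : f k with m | m
    · simp [P, h, hf, Matrix.mul_apply, Matrix.one_apply, apply_ite]
    · simp [P, h, hf, Matrix.mul_apply,
        Ideal.Quotient.eq_zero_iff_mem.2 (hd m l)]
  obtain ⟨t, ht⟩ := hG.exists_weight hC x h.det fun f n => by
    rw [hb]
    exact mem_divisibleIdeal_iff.1 (hcong f) n
  simp only [hb] at ht
  have hx1 : x Sum.inl = 1 := by
    have : P Sum.inl = 1 := by
      ext k l
      simp [P, Matrix.one_apply]
    simp only [x, this, det_one]
  have hth : h.det = t := by simpa [hx1] using ht Sum.inl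
  subst hth
  -- `det h` is the coordinate of the coaction of `x` at `w₁ ⊗ ⋯ ⊗ wᵣ`, where `x` has coordinate `1`.
  have hgroup : IsGroupLikeElem R h.det := by
    have hdet : h.det = ∑ g, x g •
        (Matrix.of fun f g : Fin r → Fin r ⊕ κ => ∏ k, c (f k) (g k)) Sum.inl g := (hb _).symm
    constructor
    · rw [hdet, map_sum]
      simp only [map_smul, hC.counit_apply, Matrix.one_apply]
      simp [hx1]
    · conv_lhs => rw [hdet]
      simp only [map_sum, map_smul, hC.comul_apply, Finset.smul_sum]
      rw [Finset.sum_comm]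
      simp only [← TensorProduct.tmul_smul, ← TensorProduct.tmul_sum, hb, ht]
      simp only [TensorProduct.tmul_smul, TensorProduct.smul_tmul', ← TensorProduct.sum_tmul,
        ← hdet]
  -- Replacing the `k`-th row of `h` by the row `i` of the lower block gives the coordinate of the
  -- coaction at an `f` which takes the value `inr i`; there `x` vanishes.
  have hcramer : cramer hᵀ (fun l => c (Sum.inr i) (Sum.inl l)) = 0 := by
    ext k
    rw [cramer_transpose_apply]
    let f : Fin r → Fin r ⊕ κ := Function.update Sum.inl k (Sum.inr i)
    have h1 : h.updateRow k (fun l => c (Sum.inr i) (Sum.inl l)) = c.submatrix f Sum.inl := by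
      ext m l
      rcases eq_or_ne m k with rfl | hm
      · simp [f]
      · simp [f, h, hm]
    have h2 : x f = 0 := det_eq_zero_of_row_eq_zero k fun l => by simp [P, f]
    rw [h1, ht, h2, zero_smul, Pi.zero_apply]
  have h3 := mulVec_cramer hᵀ (fun l => c (Sum.inr i) (Sum.inl l))
  rw [hcramer, mulVec_zero, det_transpose] at h3
  have h4 := congrFun h3 j
  simpa [hgroup.isUnit.mul_right_eq_zero] using h4.symm

open IsLocalRing

/-- Let `V` be a finitely generated subcomodule of `A` containing `a ∈ d`. Then `W = V ∩ d` is
stable modulo `d`, hence stable, and `ε` vanishes on `W`; the counit axiom gives `W = 0`. -/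
theorem IsPrudentGroupScheme.divisibleIdeal_eq_bot {R : Type u} [CommRing R] [IsDomain R]
    [IsDiscreteValuationRing R] [IsAdicComplete (maximalIdeal R) R] {A : Type v} [CommRing A]
    [HopfAlgebra R A] [Module.Flat R A] {ϖ : R} (hϖ : Irreducible ϖ)
    (hG : IsPrudentGroupScheme R A ϖ) : divisibleIdeal R A ϖ = ⊥ := by
  refine (Submodule.eq_bot_iff _).2 fun a ha => ?_
  obtain ⟨V, hVfin, haV, hV⟩ := exists_finite_subcomodule (R := R) a
  let D := (divisibleIdeal R A ϖ).restrictScalars R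
  have hDtf : Module.IsTorsionFree R (A ⧸ D) := isTorsionFree_quotient_divisibleIdeal hϖ
  obtain ⟨r, s, bV, hbD, hbi, hspan⟩ := Submodule.exists_basis_adapted V.subtype D
  have hbli : LinearIndependent R (fun i => (bV i : A)) :=
    bV.linearIndependent.map' V.subtype V.ker_subtype
  choose c hc using fun j => Submodule.exists_eq_sum_tmul bV (hV (bV j) (bV j).2)
  have hmul : Matrix.IsMultiplicative R (Matrix.of fun i j => c j i) :=
    .of_linearIndependent hbli hc
  have hcD : ∀ i j, c (Sum.inl j) (Sum.inr i) ∈ divisibleIdeal R A ϖ := fun i j => by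
    have h0 : TensorProduct.map D.mkQ D.mkQ (Coalgebra.comul (R := R) (bV (Sum.inl j) : A)) = 0 :=
      map_mkQ_comul_eq_zero hϖ (hbD j)
    have hbj : ∀ i, D.mkQ (bV (Sum.inl i)) = 0 := fun i =>
      (Submodule.Quotient.mk_eq_zero _).2 (hbD i)
    rw [hc, map_sum, Fintype.sum_sum_type] at h0
    simp only [TensorProduct.map_tmul, hbj, TensorProduct.zero_tmul, Finset.sum_const_zero,
      zero_add] at h0
    have h1 := hbi.eq_of_sum_tmul_eq (x := fun i => D.mkQ (c (Sum.inl j) (Sum.inr i))) (y := 0)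
      (by simpa using h0)
    exact (Submodule.Quotient.mk_eq_zero _).1 (congrFun h1 i)
  have hblock : ∀ i j, c (Sum.inl j) (Sum.inr i) = 0 := hG.block_eq_zero hmul hcD
  have hε : ∀ j, Coalgebra.counit (R := R) (bV (Sum.inl j) : A) = 0 := fun j =>
    counit_eq_zero_of_mem_divisibleIdeal hϖ (hbD j)
  have hzero : ∀ j, (bV (Sum.inl j) : A) = 0 := fun j => by
    have h := congrArg (TensorProduct.lid R A)
      (Coalgebra.rTensor_counit_comul (R := R) (bV (Sum.inl j) : A))
    rw [hc, Fintype.sum_sum_type] at h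
    simp only [map_sum, LinearMap.rTensor_tmul, hblock, hε, TensorProduct.tmul_zero,
      TensorProduct.zero_tmul, Finset.sum_const_zero, add_zero, map_zero, TensorProduct.lid_tmul,
      one_smul] at h
    exact h.symm
  have h0 := hspan ⟨a, haV⟩ ha
  have hbV : ∀ j, bV (Sum.inl j) = 0 := fun j => Subtype.ext (hzero j)
  simp only [hbV] at h0
  rw [Submodule.span_eq_bot.2 (by rintro _ ⟨j, rfl⟩; rfl), Submodule.mem_bot] at h0
  exact congrArg Subtype.val h0

end Prudent

theorem theorem17p10 {R : Type u} [CommRing R] [IsDomain R] [IsDiscreteValuationRing R]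
    [IsAdicComplete (IsLocalRing.maximalIdeal R) R]
    (K : Type w) [Field K] [Algebra R K] [IsFractionRing R K]
    {A : Type v} [CommRing A] [HopfAlgebra R A] [Module.Flat R A]
    (ϖ : R) (hϖ : Irreducible ϖ) (hG : IsPrudentGroupScheme R A ϖ) :
    divisibleIdeal R A ϖ = ⊥ ∧
      (Module.rank K (K ⊗[R] A) ≤ Cardinal.aleph0 → Module.Free R A) := by
  have hd := hG.divisibleIdeal_eq_bot hϖ
  refine ⟨hd, fun hK => ?_⟩
  have : IsHausdorff (IsLocalRing.maximalIdeal R) A :=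
    (isHausdorff_maximalIdeal_iff hϖ).2 fun a ha => by
      rw [← Ideal.mem_bot, ← hd]
      exact mem_divisibleIdeal_iff.2 ha
  refine free_of_rank_le_aleph0 ?_
  -- The rank of `A` over `R` is the dimension of the localization `K ⊗ A` over `K`.
  rw [IsLocalization.rank_eq K (nonZeroDivisors R) le_rfl] at hK
  have h1 := IsLocalizedModule.lift_rank_eq (nonZeroDivisors R)
    (TensorProduct.mk R K A 1) le_rfl
  rw [← Cardinal.lift_le_aleph0, ← h1, Cardinal.lift_le_aleph0]
  exact hK
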